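/- Let $H$ be a fixed finite simple graph with chromatic number $\chi(H)=4$. Then there is a function $\varepsilon_H\colon\mathbb{N}\to\mathbb{R}$, depending only on $H$, with $\varepsilon_H(n)\to 0$ as $n\to\infty$, such that every simple graph $G$ on $n$ vertices that does not contain $H$ as a (not necessarily induced) subgraph can be made bipartite by deleting at most $(1+\varepsilon_H(n))\,n^2/9$ of its edges. -/

import Mathlib

open Filter Topology

/-! For a sign vector `s`, `edgeSum w + quadForm w s` is four times the number of edges the cut
misses. If every cut misses too many, `quadForm w` is bounded below on sign vectors, and so on all
of `[-1, 1]^V` (`exists_sign_quadForm_le`).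

`H`-freeness enters only through `K₄`: a positive density of `K₄` forces a large complete 4-partite
subgraph (`exists_injective_blowUp`), hence `H`. So `G` has few `K₄`, and common neighbourhoods of
adjacent vertices span few edges on average.

Let `p` and `t` be the densities of ordered edges and triangles, and suppose every cut misses more
than about `n²/9` edges. Averaging the cuts along vertex neighbourhoods gives `t/p ≥ p - 1/2 +
1/(9p)` (`triSum_ge_of_quadForm_ge`). By Cauchy–Schwarz and averaging (`exists_rest_le`), some
triple has nearly edgeless pairwise common neighbourhoods that cover all but about `x n` vertices,
`x = 5/2 - 3p - 1/(3p)`. By Turán for `K₄` (`edgeSum_mul_le_k4Sum`) the remainder spans at most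
about `(2/3)(x n)²` ordered edges. Three cuts, each separating one of these sets from the other two
with the remainder placed fractionally, then contradict the lower bound (`density_contradiction`).
-/

/-- A symmetric `0`-`1` matrix. -/
structure IsZeroOneSymm {V : Type*} (w : V → V → ℝ) : Prop where
  symm : ∀ u v, w u v = w v u
  zero_or_one : ∀ u v, w u v = 0 ∨ w u v = 1

/-- The indicator of a triangle. -/
def tri {V : Type*} (w : V → V → ℝ) (u v z : V) : ℝ := w u v * w u z * w v z

namespace IsZeroOneSymm
variable {V : Type*} {w : V → V → ℝ}

lemma nonneg (hw : IsZeroOneSymm w) (u v : V) : 0 ≤ w u v := by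
  rcases hw.zero_or_one u v with h | h <;> simp [h]

lemma le_one (hw : IsZeroOneSymm w) (u v : V) : w u v ≤ 1 := by
  rcases hw.zero_or_one u v with h | h <;> simp [h]

lemma mul_self (hw : IsZeroOneSymm w) (u v : V) : w u v * w u v = w u v := by
  rcases hw.zero_or_one u v with h | h <;> simp [h]

lemma tri_nonneg (hw : IsZeroOneSymm w) (u v z : V) : 0 ≤ tri w u v z :=
  mul_nonneg (mul_nonneg (hw.nonneg _ _) (hw.nonneg _ _)) (hw.nonneg _ _)

lemma tri_swap_right (hw : IsZeroOneSymm w) (u v z : V) : tri w u z v = tri w u v z := by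
  simp only [tri, hw.symm z v]; ring

lemma tri_rotate (hw : IsZeroOneSymm w) (u v z : V) : tri w z u v = tri w u v z := by
  simp only [tri, hw.symm z]; ring

end IsZeroOneSymm

/-! ### Subgraph counts and Turán's theorem for `K₄`. -/

section Counts
variable {V : Type*} [Fintype V] (w : V → V → ℝ)

/-- The number of ordered edges. -/
def edgeSum : ℝ := ∑ u, ∑ v, w u v

/-- The number of common neighbours of `u` and `v`. -/
def codeg (u v : V) : ℝ := ∑ z, w u z * w v z

/-- The number of ordered triangles. -/
def triSum : ℝ := ∑ u, ∑ v, ∑ z, tri w u v z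

/-- The number of ordered triangles, weighted by the codegree of the first edge. -/
def bookSum : ℝ := ∑ u, ∑ v, ∑ z, tri w u v z * codeg w u v

/-- The number of ordered copies of `K₄`. -/
def k4Sum : ℝ := ∑ u, ∑ v, ∑ z, ∑ x, tri w u v z * (w u x * w v x * w z x)

/-- The quadratic form of `w`. -/
def quadForm (s : V → ℝ) : ℝ := ∑ u, ∑ v, w u v * (s u * s v)

/-- The number of ordered edges among the common neighbours of `u` and `v`. -/
def codegEdges (u v : V) : ℝ := ∑ x, ∑ y, (w u x * w v x) * (w u y * w v y) * w x y

variable {w}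

namespace IsZeroOneSymm

lemma edgeSum_nonneg (hw : IsZeroOneSymm w) : 0 ≤ edgeSum w :=
  Finset.sum_nonneg fun _ _ => Finset.sum_nonneg fun _ _ => hw.nonneg _ _

lemma edgeSum_le (hw : IsZeroOneSymm w) : edgeSum w ≤ (Fintype.card V : ℝ) ^ 2 := by
  calc edgeSum w ≤ ∑ _u : V, ∑ _v : V, (1 : ℝ) :=
        Finset.sum_le_sum fun u _ => Finset.sum_le_sum fun v _ => hw.le_one u v
    _ = _ := by simp [sq]

lemma triSum_nonneg (hw : IsZeroOneSymm w) : 0 ≤ triSum w :=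
  Finset.sum_nonneg fun _ _ => Finset.sum_nonneg fun _ _ => Finset.sum_nonneg fun _ _ =>
    hw.tri_nonneg _ _ _

lemma k4Sum_nonneg (hw : IsZeroOneSymm w) : 0 ≤ k4Sum w :=
  Finset.sum_nonneg fun _ _ => Finset.sum_nonneg fun _ _ => Finset.sum_nonneg fun _ _ =>
    Finset.sum_nonneg fun _ _ => mul_nonneg (hw.tri_nonneg _ _ _)
      (mul_nonneg (mul_nonneg (hw.nonneg _ _) (hw.nonneg _ _)) (hw.nonneg _ _))

lemma codegEdges_nonneg (hw : IsZeroOneSymm w) (u v : V) : 0 ≤ codegEdges w u v :=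
  Finset.sum_nonneg fun _ _ => Finset.sum_nonneg fun _ _ =>
    mul_nonneg (mul_nonneg (mul_nonneg (hw.nonneg _ _) (hw.nonneg _ _))
      (mul_nonneg (hw.nonneg _ _) (hw.nonneg _ _))) (hw.nonneg _ _)

/-- Triangle sums may be taken over the second and the third edge as well. -/
lemma sum_tri_mul_second (hw : IsZeroOneSymm w) (f : V → V → ℝ) :
    ∑ u, ∑ v, ∑ z, tri w u v z * f u z = ∑ u, ∑ v, ∑ z, tri w u v z * f u v := by
  refine Finset.sum_congr rfl fun u _ => ?_
  rw [Finset.sum_comm]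
  simp only [hw.tri_swap_right]

lemma sum_tri_mul_third (hw : IsZeroOneSymm w) (f : V → V → ℝ) :
    ∑ u, ∑ v, ∑ z, tri w u v z * f v z = ∑ u, ∑ v, ∑ z, tri w u v z * f u v := by
  rw [Finset.sum_comm]
  simp_rw [fun a : V => Finset.sum_comm (s := Finset.univ) (t := Finset.univ)
    (f := fun x z => tri w x a z * f a z)]
  refine Finset.sum_congr rfl fun u _ => Finset.sum_congr rfl fun v _ =>
    Finset.sum_congr rfl fun z _ => ?_
  rw [hw.tri_rotate]

lemma sum_tri_right (u v : V) : ∑ z, tri w u v z = w u v * codeg w u v := by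
  simp only [tri, codeg, Finset.mul_sum, mul_assoc]

/-- Cauchy–Schwarz over the ordered edges, applied to the codegree. -/
lemma triSum_sq_le (hw : IsZeroOneSymm w) : triSum w ^ 2 ≤ edgeSum w * bookSum w := by
  have h := Finset.sum_mul_sq_le_sq_mul_sq (Finset.univ : Finset (V × V))
    (fun e => w e.1 e.2) (fun e => w e.1 e.2 * codeg w e.1 e.2)
  simp only [Fintype.sum_prod_type, ← mul_assoc, pow_two, hw.mul_self] at h
  have h1 : ∀ u v, w u v * codeg w u v * w u v * codeg w u v
      = w u v * codeg w u v * codeg w u v := by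
    intro u v
    rw [mul_right_comm (w u v) _ (w u v), hw.mul_self]
  simp only [h1] at h
  simpa only [triSum, edgeSum, bookSum, sum_tri_right, ← Finset.sum_mul, pow_two] using h

/-- Cauchy–Schwarz for the degrees. Here `d` indicates a vertex set containing all edges, so that
Turán's bound can later use the size of an induced subgraph instead of `|V|`. -/
lemma edgeSum_sq_le (hw : IsZeroOneSymm w) {d : V → ℝ} (hd : ∀ v, d v = 0 ∨ d v = 1)
    (hwd : ∀ u v, w u v ≤ d v) :
    edgeSum w ^ 2 ≤ (∑ v, d v) * ∑ u, (∑ v, w u v) ^ 2 := by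
  have h := Finset.sum_mul_sq_le_sq_mul_sq (Finset.univ : Finset V) d (fun u => ∑ v, w u v)
  have h1 : ∀ u, d u * ∑ v, w u v = ∑ v, w u v := by
    intro u
    rcases hd u with h0 | h0
    · rw [h0, zero_mul, eq_comm]
      refine Finset.sum_eq_zero fun v _ => le_antisymm ?_ (hw.nonneg _ _)
      rw [hw.symm, ← h0]; exact hwd v u
    · rw [h0, one_mul]
  have h2 : ∀ u, d u ^ 2 = d u := by
    intro u; rcases hd u with h0 | h0 <;> simp [h0]
  simpa only [h1, h2, edgeSum] using h

/-- Inclusion–exclusion: two neighbourhoods inside the set `d` meet in at least the sum of their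
sizes minus the size of `d`. -/
lemma triSum_ge (hw : IsZeroOneSymm w) {d : V → ℝ} (hd : ∀ v, d v = 0 ∨ d v = 1)
    (hwd : ∀ u v, w u v ≤ d v) :
    2 * ∑ u, (∑ v, w u v) ^ 2 - (∑ v, d v) * edgeSum w ≤ triSum w := by
  have h1 : ∑ u, ∑ v, ∑ z, w u v * (w u z + w v z - d z) ≤ triSum w := by
    refine Finset.sum_le_sum fun u _ => Finset.sum_le_sum fun v _ =>
      Finset.sum_le_sum fun z _ => ?_
    rw [tri, mul_assoc]
    refine mul_le_mul_of_nonneg_left ?_ (hw.nonneg _ _)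
    have h2 := hwd u z
    have h3 := hwd v z
    rcases hw.zero_or_one u z with h | h <;> rcases hw.zero_or_one v z with h' | h' <;>
      rcases hd z with h'' | h'' <;> simp only [h, h', h''] at h2 h3 ⊢ <;> linarith
  have h2 : ∑ u, ∑ v, ∑ z, w u v * (w u z + w v z - d z)
      = 2 * ∑ u, (∑ v, w u v) ^ 2 - (∑ v, d v) * edgeSum w := by
    have e1 : ∑ u, ∑ v, ∑ z, w u v * w u z = ∑ u, (∑ v, w u v) ^ 2 := by
      simp only [sq, Finset.sum_mul_sum]
    have e2 : ∑ u, ∑ v, ∑ z, w u v * w v z = ∑ u, (∑ v, w u v) ^ 2 := by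
      rw [Finset.sum_comm, ← e1]
      simp only [fun u v => hw.symm v u]
    have e3 : ∑ u, ∑ v, ∑ z, w u v * d z = (∑ v, d v) * edgeSum w := by
      simp only [edgeSum, ← Finset.mul_sum, ← Finset.sum_mul]
      ring
    simp only [mul_sub, mul_add, Finset.sum_sub_distrib, Finset.sum_add_distrib, e1, e2, e3]
    ring
  linarith

lemma three_bookSum_eq (hw : IsZeroOneSymm w) :
    3 * bookSum w = ∑ u, ∑ v, ∑ z, tri w u v z * (codeg w u v + codeg w u z + codeg w v z) := by
  simp only [mul_add, Finset.sum_add_distrib, hw.sum_tri_mul_second, hw.sum_tri_mul_third]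
  simp only [bookSum]
  ring

/-- A vertex adjacent to 0, 1, 2 or 3 vertices of a triangle lies in 0, 0, 1 or 3 of its pairwise
common neighbourhoods; the value 3 occurs only in a `K₄`. -/
lemma three_bookSum_le (hw : IsZeroOneSymm w) {d : V → ℝ} (hd : ∀ v, d v = 0 ∨ d v = 1)
    (hwd : ∀ u v, w u v ≤ d v) :
    3 * bookSum w ≤ (∑ v, d v) * triSum w + 2 * k4Sum w := by
  have h1 : (∑ v, d v) * triSum w + 2 * k4Sum w
      = ∑ u, ∑ v, ∑ z, tri w u v z * ∑ x, (d x + 2 * (w u x * w v x * w z x)) := by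
    simp only [Finset.sum_add_distrib, mul_add, ← Finset.mul_sum, k4Sum, triSum,
      ← Finset.sum_mul, mul_left_comm _ (2 : ℝ)]
    ring
  rw [h1, hw.three_bookSum_eq]
  refine Finset.sum_le_sum fun u _ => Finset.sum_le_sum fun v _ =>
    Finset.sum_le_sum fun z _ => mul_le_mul_of_nonneg_left ?_ (hw.tri_nonneg _ _ _)
  simp only [codeg, ← Finset.sum_add_distrib]
  refine Finset.sum_le_sum fun x _ => ?_
  have h2 := hwd u x
  have h3 := hwd v x
  have h4 := hwd z x
  rcases hw.zero_or_one u x with h | h <;> rcases hw.zero_or_one v x with h' | h' <;>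
    rcases hw.zero_or_one z x with h'' | h'' <;>
    rcases hd x with h0 | h0 <;> simp only [h, h', h'', h0] at h2 h3 h4 ⊢ <;> linarith

/-- An approximate form of Turán's theorem for `K₄`. -/
theorem edgeSum_mul_le_k4Sum (hw : IsZeroOneSymm w) {d : V → ℝ} (hd : ∀ v, d v = 0 ∨ d v = 1)
    (hwd : ∀ u v, w u v ≤ d v) :
    edgeSum w * (3 * edgeSum w - 2 * (∑ v, d v) ^ 2) ≤ 3 * k4Sum w := by
  set n := ∑ v, d v with hn
  have h0 := hw.edgeSum_nonneg
  have hK := hw.k4Sum_nonneg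
  have hT := hw.triSum_nonneg
  have hn0 : 0 ≤ n := Finset.sum_nonneg fun v _ => by rcases hd v with h | h <;> simp [h]
  have h1 := hw.edgeSum_sq_le hd hwd
  have h2 := hw.triSum_ge hd hwd
  have h3 := hw.three_bookSum_le hd hwd
  have h4 := hw.triSum_sq_le
  rw [← hn] at h1 h2 h3
  set P := edgeSum w
  set T := triSum w
  set K := k4Sum w
  set S := bookSum w
  set E := ∑ u, (∑ v, w u v) ^ 2
  by_contra! hc
  have hP : 0 < P := by
    rcases h0.eq_or_lt with h | h
    · rw [← h] at hc; linarith
    · exact h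
  have hPn : 0 < 3 * P - 2 * n ^ 2 := by
    by_contra! h
    nlinarith [mul_nonneg h0 (sub_nonneg.2 h)]
  have hn1 : 0 < n := by
    rcases hn0.eq_or_lt with h | h
    · rw [← h] at h1; nlinarith
    · exact h
  -- With `3P > 2n²`, `a1` gives `T ≥ Pn/3`. The excess `3T - Pn` is then bounded below by `a4` and
  -- above, in terms of `K`, by `a6`.
  have a1 : P * (2 * P - n ^ 2) ≤ n * T := by nlinarith
  have a2 : 3 * T ^ 2 ≤ P * (n * T + 2 * K) := by nlinarith
  have a3 : P * n / 3 ≤ T := by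
    have : n * (P * n / 3) ≤ n * T := by nlinarith
    exact le_of_mul_le_mul_left this hn1
  have a4 : 2 * P * (3 * P - 2 * n ^ 2) ≤ n * (3 * T - P * n) := by nlinarith
  have a5 : (n * P / 3) * (3 * T - P * n) ≤ 2 * K * P := by
    have : T * (3 * T - P * n) ≤ 2 * K * P := by nlinarith
    nlinarith
  have a6 : n * (3 * T - P * n) ≤ 6 * K := by
    have : P * (n * (3 * T - P * n)) ≤ P * (6 * K) := by nlinarith
    exact le_of_mul_le_mul_left this hP
  nlinarith

end IsZeroOneSymm
end Counts

/-! ### Cuts as values of the quadratic form. -/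

/-- The indicator of being adjacent to at most one of `u`, `v`, `z`. -/
def rest {V : Type*} (w : V → V → ℝ) (u v z x : V) : ℝ :=
  1 - w u x * w v x - w u x * w z x - w v x * w z x + 2 * (w u x * w v x * w z x)

lemma IsZeroOneSymm.rest_zero_or_one {V : Type*} {w : V → V → ℝ} (hw : IsZeroOneSymm w)
    (u v z x : V) : rest w u v z x = 0 ∨ rest w u v z x = 1 := by
  rcases hw.zero_or_one u x with h | h <;> rcases hw.zero_or_one v x with h' | h' <;>
    rcases hw.zero_or_one z x with h'' | h'' <;> norm_num [rest, h, h', h'']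

section QuadForm
variable {V : Type*} [Fintype V] {w : V → V → ℝ}

namespace IsZeroOneSymm

/-- The zero diagonal removes the `r ^ 2` term: the form is affine in each coordinate. -/
lemma quadForm_add_smul_single [DecidableEq V] (hw : IsZeroOneSymm w) (h0 : ∀ v, w v v = 0)
    (s : V → ℝ) (a : V) (r : ℝ) :
    quadForm w (fun v => s v + r * if v = a then 1 else 0)
      = quadForm w s + 2 * r * ∑ v, w a v * s v := by
  have h1 : ∀ u v, w u v * ((s u + r * if u = a then 1 else 0) * (s v + r * if v = a then 1 else 0))
      = w u v * (s u * s v) + (if v = a then r * (w u v * s u) else 0)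
        + (if u = a then r * (w u v * s v) else 0)
        + (if u = a then (if v = a then r ^ 2 * w u v else 0) else 0) := by
    intro u v
    split_ifs <;> ring
  have h2 : ∀ u, w u a = w a u := fun u => hw.symm u a
  simp only [quadForm, h1, Finset.sum_add_distrib, Finset.sum_ite_eq', Finset.mem_univ, if_true,
    Finset.sum_ite_irrel, Finset.sum_const_zero, h0, h2, ← Finset.mul_sum]
  ring

/-- A vector with entries in `[-1, 1]` can be rounded to a sign vector without increasing the
quadratic form. -/
theorem exists_sign_quadForm_le (hw : IsZeroOneSymm w) (h0 : ∀ v, w v v = 0)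
    (s : V → ℝ) (hs : ∀ v, |s v| ≤ 1) :
    ∃ t : V → ℝ, (∀ v, t v = 1 ∨ t v = -1) ∧ quadForm w t ≤ quadForm w s := by
  classical
  suffices h : ∀ A : Finset V, ∃ t : V → ℝ, (∀ v ∈ A, t v = 1 ∨ t v = -1) ∧
      quadForm w t ≤ quadForm w s ∧ ∀ v, |t v| ≤ 1 by
    obtain ⟨t, h1, h2, -⟩ := h Finset.univ
    exact ⟨t, fun v => h1 v (Finset.mem_univ v), h2⟩
  intro A
  induction A using Finset.induction_on with
  | empty => exact ⟨s, by simp, le_rfl, hs⟩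
  | insert a A _ ih =>
    obtain ⟨t, h1, h2, h3⟩ := ih
    -- An affine function of the coordinate `a` does not increase towards one of the endpoints `±1`.
    obtain ⟨e, he, hel⟩ : ∃ e : ℝ, (e = 1 ∨ e = -1) ∧ (e - t a) * ∑ v, w a v * t v ≤ 0 := by
      have := abs_le.1 (h3 a)
      rcases le_total 0 (∑ v, w a v * t v) with h | h
      · exact ⟨-1, Or.inr rfl, mul_nonpos_of_nonpos_of_nonneg (by linarith) h⟩
      · exact ⟨1, Or.inl rfl, mul_nonpos_of_nonneg_of_nonpos (by linarith) h⟩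
    have hval : ∀ v, t v + (e - t a) * (if v = a then 1 else 0) = if v = a then e else t v := by
      intro v
      split_ifs with h
      · rw [h]; ring
      · ring
    refine ⟨fun v => t v + (e - t a) * if v = a then 1 else 0, ?_, ?_, ?_⟩
    · intro v hv
      simp only [hval]
      split_ifs with h
      · exact he
      · exact h1 v ((Finset.mem_insert.1 hv).resolve_left h)
    · rw [hw.quadForm_add_smul_single h0]
      linarith
    · intro v
      simp only [hval]
      split_ifs with h
      · rcases he with h | h <;> simp [h]
      · exact h3 v

/-- Cutting along the neighbourhoods of the vertices yields many triangles. -/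
lemma triSum_ge_of_quadForm_ge (hw : IsZeroOneSymm w) {B : ℝ}
    (hB : ∀ s : V → ℝ, (∀ v, |s v| ≤ 1) → -B ≤ quadForm w s) :
    4 * edgeSum w ^ 2 ≤ Fintype.card V * (4 * triSum w + Fintype.card V * (edgeSum w + B)) := by
  -- `2 * w a v - 1` is the sign vector of the cut between the neighbourhood of `a` and its
  -- complement.
  have h1 : ∑ _a : V, -B ≤ ∑ a, quadForm w (fun v => 2 * w a v - 1) := by
    refine Finset.sum_le_sum fun a _ => hB _ fun v => ?_
    rcases hw.zero_or_one a v with h | h <;> rw [h] <;> norm_num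
  have h2 : ∑ a, quadForm w (fun v => 2 * w a v - 1)
      = 4 * triSum w - 4 * ∑ u, (∑ v, w u v) ^ 2 + Fintype.card V * edgeSum w := by
    have e0 : ∀ a u v, w u v * ((2 * w a u - 1) * (2 * w a v - 1))
        = 4 * tri w a u v - 2 * (w u v * w u a) - 2 * (w v u * w v a) + w u v := by
      intro a u v
      rw [hw.symm u a, hw.symm v a, hw.symm v u, tri]; ring
    have e1 : ∑ a, ∑ u, ∑ v, w u v * w u a = ∑ u, (∑ v, w u v) ^ 2 := by
      rw [Finset.sum_comm]
      refine Finset.sum_congr rfl fun u _ => ?_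
      rw [sq, Finset.sum_mul_sum, Finset.sum_comm]
    have e2 : ∑ a, ∑ u, ∑ v, w v u * w v a = ∑ u, (∑ v, w u v) ^ 2 := by
      rw [← e1]
      exact Finset.sum_congr rfl fun a _ => Finset.sum_comm
    simp only [quadForm, e0, Finset.sum_add_distrib, Finset.sum_sub_distrib, ← Finset.mul_sum,
      e1, e2, Finset.sum_const, Finset.card_univ, nsmul_eq_mul, triSum, edgeSum]
    ring
  have h3 := hw.edgeSum_sq_le (d := fun _ => 1) (fun _ => Or.inr rfl) hw.le_one
  rw [h2] at h1
  simp only [Finset.sum_const, Finset.card_univ, nsmul_eq_mul, mul_one] at h1 h3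
  have h4 : (0 : ℝ) ≤ Fintype.card V := Nat.cast_nonneg _
  nlinarith

/-- The three cuts defined by a partition of the vertices into four parts. -/
lemma quadForm_partition (hw : IsZeroOneSymm w) {B : ℝ}
    (hB : ∀ s : V → ℝ, (∀ v, |s v| ≤ 1) → -B ≤ quadForm w s)
    {a b c d : V → ℝ} (ha : ∀ v, 0 ≤ a v) (hb : ∀ v, 0 ≤ b v) (hc : ∀ v, 0 ≤ c v)
    (hd : ∀ v, 0 ≤ d v) (h1 : ∀ v, a v + b v + c v + d v = 1) {r : ℝ} (hr0 : 0 ≤ r)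
    (hr1 : r ≤ 1) :
    -(3 * B) ≤ 4 * (quadForm w a + quadForm w b + quadForm w c) - r * edgeSum w
      + (r + 3 * r ^ 2) * quadForm w d := by
  have hA := hB (fun v => a v - b v - c v + r * d v) fun v => abs_le.2 <| by
    constructor <;> nlinarith [ha v, hb v, hc v, hd v, h1 v, mul_nonneg hr0 (hd v)]
  have hB' := hB (fun v => -a v + b v - c v + r * d v) fun v => abs_le.2 <| by
    constructor <;> nlinarith [ha v, hb v, hc v, hd v, h1 v, mul_nonneg hr0 (hd v)]
  have hC := hB (fun v => -a v - b v + c v + r * d v) fun v => abs_le.2 <| by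
    constructor <;> nlinarith [ha v, hb v, hc v, hd v, h1 v, mul_nonneg hr0 (hd v)]
  refine le_trans (b := quadForm w (fun v => a v - b v - c v + r * d v)
    + quadForm w (fun v => -a v + b v - c v + r * d v)
    + quadForm w (fun v => -a v - b v + c v + r * d v)) (by linarith only [hA, hB', hC]) ?_
  simp only [quadForm, edgeSum, ← Finset.sum_add_distrib, Finset.mul_sum,
    ← Finset.sum_sub_distrib]
  refine Finset.sum_le_sum fun u _ => Finset.sum_le_sum fun v _ => ?_
  -- For `r = 1` the three cuts add up exactly; for `r < 1` the edges within `a + b + c` leave a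
  -- nonnegative slack.
  have key : 4 * (a u * a v + b u * b v + c u * c v)
      - r * ((a u + b u + c u + d u) * (a v + b v + c v + d v)) + (r + 3 * r ^ 2) * (d u * d v)
      - ((a u - b u - c u + r * d u) * (a v - b v - c v + r * d v)
        + (-a u + b u - c u + r * d u) * (-a v + b v - c v + r * d v)
        + (-a u - b u + c u + r * d u) * (-a v - b v + c v + r * d v))
      = (1 - r) * ((a u + b u + c u) * (a v + b v + c v)) := by ring
  have h2 : 0 ≤ (1 - r) * ((a u + b u + c u) * (a v + b v + c v)) :=
    mul_nonneg (by linarith) (mul_nonneg (by linarith [ha u, hb u, hc u])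
      (by linarith [ha v, hb v, hc v]))
  rw [← key, h1, h1] at h2
  have h3 := mul_nonneg (hw.nonneg u v) h2
  linarith only [h3]

end IsZeroOneSymm

end QuadForm

/-! ### Averaging over triangles. -/

section Average
variable {V : Type*} [Fintype V] {w : V → V → ℝ}

namespace IsZeroOneSymm

lemma edgeSum_restrict_mul_le_k4Sum (hw : IsZeroOneSymm w) {d : V → ℝ}
    (hd : ∀ v, d v = 0 ∨ d v = 1) :
    quadForm w d * (3 * quadForm w d - 2 * (∑ v, d v) ^ 2) ≤ 3 * k4Sum w := by
  have hd0 : ∀ v, 0 ≤ d v := fun v => by rcases hd v with h | h <;> simp [h]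
  have hd1 : ∀ v, d v ≤ 1 := fun v => by rcases hd v with h | h <;> simp [h]
  have hw' : IsZeroOneSymm (fun u v => w u v * (d u * d v)) := by
    refine ⟨fun u v => by rw [hw.symm u v, mul_comm (d u)], fun u v => ?_⟩
    rcases hw.zero_or_one u v with h | h <;> rcases hd u with h' | h' <;>
      rcases hd v with h'' | h'' <;> simp [h, h', h'']
  have hle : ∀ u v, w u v * (d u * d v) ≤ w u v := fun u v =>
    mul_le_of_le_one_right (hw.nonneg u v) (mul_le_one₀ (hd1 u) (hd0 v) (hd1 v))
  have h := hw'.edgeSum_mul_le_k4Sum hd fun u v => by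
    rcases hd v with h | h
    · simp [h]
    · rw [h]; exact (hw'.le_one u v).trans_eq' (by rw [h])
  have hK : k4Sum (fun u v => w u v * (d u * d v)) ≤ k4Sum w := by
    refine Finset.sum_le_sum fun u _ => Finset.sum_le_sum fun v _ =>
      Finset.sum_le_sum fun z _ => Finset.sum_le_sum fun x _ => ?_
    have h1 := hw'.nonneg
    have h2 := hw.nonneg
    refine mul_le_mul ?_ ?_ ?_ (hw.tri_nonneg _ _ _)
    · exact mul_le_mul (mul_le_mul (hle _ _) (hle _ _) (h1 _ _) (h2 _ _)) (hle _ _) (h1 _ _)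
        (mul_nonneg (h2 _ _) (h2 _ _))
    · exact mul_le_mul (mul_le_mul (hle _ _) (hle _ _) (h1 _ _) (h2 _ _)) (hle _ _) (h1 _ _)
        (mul_nonneg (h2 _ _) (h2 _ _))
    · exact mul_nonneg (mul_nonneg (h1 _ _) (h1 _ _)) (h1 _ _)
  exact h.trans (by linarith)

/-- The three cuts defined by a triangle. -/
lemma quadForm_triangle (hw : IsZeroOneSymm w) {B : ℝ}
    (hB : ∀ s : V → ℝ, (∀ v, |s v| ≤ 1) → -B ≤ quadForm w s) (u v z : V) {r : ℝ} (hr0 : 0 ≤ r)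
    (hr1 : r ≤ 1) :
    -(3 * B) ≤ 4 * (codegEdges w u v + codegEdges w u z + codegEdges w v z) - r * edgeSum w
      + (r + 3 * r ^ 2) * quadForm w (rest w u v z) := by
  have hn := hw.nonneg
  have h1 : ∀ u x, 0 ≤ 1 - w u x := fun u x => sub_nonneg.2 (hw.le_one u x)
  -- Common neighbours of all three vertices are kept in the first part only, which makes the parts
  -- disjoint.
  have h := hw.quadForm_partition hB (a := fun x => w u x * w v x)
    (b := fun x => w u x * w z x * (1 - w v x)) (c := fun x => w v x * w z x * (1 - w u x))
    (d := rest w u v z) (fun x => mul_nonneg (hn _ _) (hn _ _))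
    (fun x => mul_nonneg (mul_nonneg (hn _ _) (hn _ _)) (h1 _ _))
    (fun x => mul_nonneg (mul_nonneg (hn _ _) (hn _ _)) (h1 _ _))
    (fun x => by rcases hw.rest_zero_or_one u v z x with h | h <;> simp [h])
    (fun x => by rw [rest]; ring) hr0 hr1
  have key : ∀ u v : V, ∀ f : V → ℝ, (∀ x, 0 ≤ f x) → (∀ x, f x ≤ w u x * w v x) →
      quadForm w f ≤ codegEdges w u v := by
    intro u v f hf0 hf
    refine Finset.sum_le_sum fun x _ => Finset.sum_le_sum fun y _ => ?_
    rw [mul_comm (w x y)]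
    exact mul_le_mul_of_nonneg_right (mul_le_mul (hf x) (hf y) (hf0 y)
      (mul_nonneg (hn _ _) (hn _ _))) (hn _ _)
  have ha := key u v (fun x => w u x * w v x) (fun x => mul_nonneg (hn _ _) (hn _ _))
    (fun x => le_rfl)
  have hb := key u z (fun x => w u x * w z x * (1 - w v x))
    (fun x => mul_nonneg (mul_nonneg (hn _ _) (hn _ _)) (h1 _ _))
    (fun x => mul_le_of_le_one_right (mul_nonneg (hn _ _) (hn _ _)) (by linarith [hn v x]))
  have hc := key v z (fun x => w v x * w z x * (1 - w u x))
    (fun x => mul_nonneg (mul_nonneg (hn _ _) (hn _ _)) (h1 _ _))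
    (fun x => mul_le_of_le_one_right (mul_nonneg (hn _ _) (hn _ _)) (by linarith [hn u x]))
  linarith

lemma sum_tri_mul_rest (hw : IsZeroOneSymm w) :
    ∑ u, ∑ v, ∑ z, tri w u v z * ∑ x, rest w u v z x
      = Fintype.card V * triSum w - 3 * bookSum w + 2 * k4Sum w := by
  rw [hw.three_bookSum_eq]
  simp only [rest, codeg, Finset.sum_add_distrib, Finset.sum_sub_distrib, mul_add, mul_sub,
    ← Finset.mul_sum, k4Sum, triSum, mul_left_comm _ (2 : ℝ), Finset.sum_const, Finset.card_univ,
    nsmul_eq_mul, ← Finset.sum_mul, mul_one]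
  ring

/-- An edge inside the common neighbourhood of an edge `u v` completes a `K₄`; dropping the
condition on `z` costs the factor `|V|`. -/
lemma sum_tri_mul_codegEdges_le (hw : IsZeroOneSymm w) :
    ∑ u, ∑ v, ∑ z, tri w u v z * codegEdges w u v ≤ Fintype.card V * k4Sum w := by
  have h1 : ∀ u v z, tri w u v z * codegEdges w u v ≤ w u v * codegEdges w u v := by
    intro u v z
    refine mul_le_mul_of_nonneg_right ?_ (hw.codegEdges_nonneg u v)
    rw [tri, mul_assoc]
    exact mul_le_of_le_one_right (hw.nonneg _ _)
      (mul_le_one₀ (hw.le_one _ _) (hw.nonneg _ _) (hw.le_one _ _))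
  refine (Finset.sum_le_sum fun u _ => Finset.sum_le_sum fun v _ =>
    Finset.sum_le_sum fun z _ => h1 u v z).trans_eq ?_
  simp only [Finset.sum_const, Finset.card_univ, nsmul_eq_mul, ← Finset.mul_sum, k4Sum]
  congr 1
  refine Finset.sum_congr rfl fun u _ => Finset.sum_congr rfl fun v _ => ?_
  simp only [codegEdges, Finset.mul_sum]
  refine Finset.sum_congr rfl fun z _ => Finset.sum_congr rfl fun x _ => ?_
  rw [tri]; ring

/-- Some triple of vertices has few vertices outside its common neighbourhoods and few edges
inside them. -/
lemma exists_rest_le (hw : IsZeroOneSymm w) (hT : 0 < triSum w) {c : ℝ} (hc : 0 ≤ c) :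
    ∃ u v z : V, (∑ x, rest w u v z x + c * (codegEdges w u v + codegEdges w u z
      + codegEdges w v z)) * triSum w ≤ Fintype.card V * triSum w - 3 * bookSum w
        + 2 * k4Sum w + 3 * c * (Fintype.card V * k4Sum w) := by
  by_contra! hcon
  set R := Fintype.card V * triSum w - 3 * bookSum w
        + 2 * k4Sum w + 3 * c * (Fintype.card V * k4Sum w) with hR
  set F : V → V → V → ℝ := fun u v z => ∑ x, rest w u v z x + c * (codegEdges w u v
    + codegEdges w u z + codegEdges w v z) with hF
  have h1 : ∑ u, ∑ v, ∑ z, tri w u v z * F u v z ≤ R := by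
    have e : ∑ u, ∑ v, ∑ z, tri w u v z * F u v z
        = ∑ u, ∑ v, ∑ z, tri w u v z * ∑ x, rest w u v z x
          + c * (3 * ∑ u, ∑ v, ∑ z, tri w u v z * codegEdges w u v) := by
      simp only [hF, mul_add, Finset.sum_add_distrib, mul_left_comm _ c, ← Finset.mul_sum,
        hw.sum_tri_mul_second, hw.sum_tri_mul_third]
      ring
    rw [e, hw.sum_tri_mul_rest]
    nlinarith [hw.sum_tri_mul_codegEdges_le]
  have h2 : ∑ e : V × V × V, tri w e.1 e.2.1 e.2.2 * R
      < ∑ e : V × V × V, tri w e.1 e.2.1 e.2.2 * (F e.1 e.2.1 e.2.2 * triSum w) := by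
    obtain ⟨e, he⟩ : ∃ e : V × V × V, 0 < tri w e.1 e.2.1 e.2.2 := by
      by_contra! h
      refine hT.not_ge ?_
      exact Finset.sum_nonpos fun u _ => Finset.sum_nonpos fun v _ =>
        Finset.sum_nonpos fun z _ => h (u, v, z)
    exact Finset.sum_lt_sum
      (fun e _ => mul_le_mul_of_nonneg_left (hcon _ _ _).le (hw.tri_nonneg _ _ _))
      ⟨e, Finset.mem_univ _, mul_lt_mul_of_pos_left (hcon _ _ _) he⟩
  simp only [Fintype.sum_prod_type, ← mul_assoc, ← Finset.sum_mul] at h2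
  change triSum w * R < _ at h2
  nlinarith

end IsZeroOneSymm
end Average

/-! ### Numerical inequalities between densities. -/

/-- After clearing denominators this is the cubic inequality `h1`. It fails at `p = 4 / 9`, hence
the lower bound on `p`. -/
lemma sq_le_of_mul_eq {p x : ℝ} (hp : 475 / 1000 ≤ p) (hp' : p ≤ 2 / 3)
    (hx : x * (6 * p) = (6 * p - 1) * (2 - 3 * p)) : 8 / 3 * x ^ 2 ≤ 4 / 3 - 2 * p := by
  have h1 : (6 * p - 1) ^ 2 * (2 - 3 * p) ≤ 9 * p ^ 2 := by
    nlinarith [mul_nonneg (mul_nonneg (sub_nonneg.2 hp) (sub_nonneg.2 hp)) (sub_nonneg.2 hp),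
      mul_nonneg (sub_nonneg.2 hp) (sub_nonneg.2 hp)]
  have h2 := mul_le_mul_of_nonneg_right h1 (by linarith : (0 : ℝ) ≤ 2 - 3 * p)
  have h3 : (x * (6 * p)) ^ 2 = (6 * p - 1) ^ 2 * (2 - 3 * p) * (2 - 3 * p) := by rw [hx]; ring
  have h4 : p ^ 2 * (4 * x ^ 2) ≤ p ^ 2 * (2 - 3 * p) := by linarith
  linarith [le_of_mul_le_mul_left h4 (by positivity)]

/-- The numerical contradiction at the end of the argument, in terms of densities. -/
lemma density_contradiction {p t s k e D Z h : ℝ} (he : 0 < e) (_ : e ≤ 1) (hp1 : p ≤ 1)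
    (hp : 4 / 9 + 2 * e ≤ p) (ht : 4 * p ^ 2 ≤ 4 * t + (p + (p - 4 / 9 - 2 * e)))
    (hs : t ^ 2 ≤ p * s) (hk : k ≤ e ^ 2 / 100) (hD0 : 0 ≤ D) (hZ0 : 0 ≤ Z)
    (hD : (D + 2 / e * Z) * t ≤ t - 3 * s + 2 * k + 3 * (2 / e) * k)
    (hQ : ∀ r : ℝ, 0 ≤ r → r ≤ 1 →
      -(3 * (p - 4 / 9 - 2 * e)) ≤ 4 * Z - r * p + (r + 3 * r ^ 2) * h)
    (hh : h * (3 * h - 2 * D ^ 2) ≤ 3 * k) : False := by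
  have ht0 : 8 / 100 ≤ t := by nlinarith [sq_nonneg (p - 4 / 9)]
  have hp0 : 0 < p := by linarith
  have hsk : 3 * t / p ≤ 3 * s / t := by
    rw [div_le_div_iff₀ hp0 (by linarith)]; nlinarith
  have hke : k / e ≤ e / 100 := by
    rw [div_le_iff₀ he]; nlinarith
  have hD' : D + 2 / e * Z ≤ 1 - 3 * t / p + 3 / 2 * e := by
    have h1 : D + 2 / e * Z ≤ (t - 3 * s + 2 * k + 3 * (2 / e) * k) / t := by
      rwa [le_div_iff₀ (by linarith)]
    have h2 : (t - 3 * s + 2 * k + 3 * (2 / e) * k) / t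
        = 1 - 3 * s / t + (2 * k + 6 * (k / e)) / t := by
      field_simp
      ring
    have h3 : (2 * k + 6 * (k / e)) / t ≤ 3 / 2 * e := by
      rw [div_le_iff₀ (by linarith)]; nlinarith
    linarith
  -- The gain `e / 2`, taken three times, absorbs the error `3 / 2 * e` in `hD'`.
  have htp : p - 1 / 2 + 1 / 9 / p + e / 2 ≤ t / p := by
    have h1 : p - 1 / 2 + 1 / 9 / p + e / 2 = (p ^ 2 - p / 2 + 1 / 9 + e / 2 * p) / p := by
      field_simp
    rw [h1]
    refine div_le_div_of_nonneg_right ?_ hp0.le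
    nlinarith
  have hD2 : D + 2 / e * Z ≤ 5 / 2 - 3 * p - 1 / 3 / p := by
    have e1 : 3 * t / p = 3 * (t / p) := by ring
    have e2 : 1 / 3 / p = 3 * (1 / 9 / p) := by ring
    rw [e1] at hD'; rw [e2]; linarith
  have hY0 : 0 ≤ 2 / e * Z := by positivity
  set x := 5 / 2 - 3 * p - 1 / 3 / p with hx
  have hxp : x * (6 * p) = (6 * p - 1) * (2 - 3 * p) := by
    rw [hx]; field_simp; ring
  have hx0 : 0 ≤ x := by linarith
  have hp23 : p ≤ 2 / 3 := by
    by_contra! h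
    nlinarith [mul_nonneg hx0 hp0.le]
  -- `5 / 12` is the value of `x` at `p = 4 / 9`, beyond which `x` decreases.
  have hx5 : x ≤ 5 / 12 := by
    have : x * (6 * p) ≤ 5 / 12 * (6 * p) := by rw [hxp]; nlinarith
    exact le_of_mul_le_mul_right this (by linarith)
  have hZ : Z ≤ e / 2 := by
    have h1 : 2 / e * Z ≤ 1 := by linarith
    rw [div_mul_eq_mul_div, div_le_one he] at h1
    linarith
  have hDx : D ^ 2 ≤ x ^ 2 := by
    have : D ≤ x := by linarith
    exact pow_le_pow_left₀ hD0 this 2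
  have hh' : h ≤ 2 / 3 * x ^ 2 + e / 10 := by
    by_contra! hc
    have h1 : e / 10 < h := by linarith [sq_nonneg x]
    have h2 : 3 * e / 10 < 3 * h - 2 * D ^ 2 := by linarith
    have h3 : e / 10 * (3 * e / 10) < h * (3 * h - 2 * D ^ 2) :=
      mul_lt_mul'' h1 h2 (by positivity) (by positivity)
    have h4 : e / 10 * (3 * e / 10) = 3 * (e ^ 2 / 100) := by ring
    linarith
  -- For `p` near `4 / 9` the remainder can be too large to be placed wholly on one side, so `r = 1
  -- / 2` is used there.
  rcases le_total p (475 / 1000) with hpl | hpl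
  · have h1 := hQ (1 / 2) (by norm_num) (by norm_num)
    have h2 : x ^ 2 ≤ (5 / 12) ^ 2 := pow_le_pow_left₀ hx0 hx5 2
    norm_num at h1 h2
    linarith
  · have h1 := hQ 1 (by norm_num) (by norm_num)
    have h3 := sq_le_of_mul_eq hpl hp23 hxp
    norm_num at h1
    linarith

/-! ### The cut theorem for graphs with few `K₄`. -/

section Cut
variable {V : Type*} [Fintype V] {w : V → V → ℝ}

/-- A graph with few copies of `K₄` has a cut which misses at most roughly `n ^ 2 / 9` edges. -/
theorem IsZeroOneSymm.exists_sign_quadForm_le_card_sq [Nonempty V] (hw : IsZeroOneSymm w)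
    (h0 : ∀ v, w v v = 0) {e : ℝ} (he : 0 < e) (he1 : e ≤ 1)
    (hK : k4Sum w ≤ e ^ 2 / 100 * (Fintype.card V : ℝ) ^ 4) :
    ∃ s : V → ℝ, (∀ v, s v = 1 ∨ s v = -1) ∧
      edgeSum w + quadForm w s ≤ (4 / 9 + 2 * e) * (Fintype.card V : ℝ) ^ 2 := by
  by_contra! hcon
  set n : ℝ := (Fintype.card V : ℝ) with hn
  have hn0 : 0 < n := by rw [hn]; exact_mod_cast Fintype.card_pos
  have hB : ∀ s : V → ℝ, (∀ v, |s v| ≤ 1) →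
      -(edgeSum w - (4 / 9 + 2 * e) * n ^ 2) ≤ quadForm w s := by
    intro s hs
    obtain ⟨t, ht, hts⟩ := hw.exists_sign_quadForm_le h0 s hs
    linarith [hcon t ht]
  set B := edgeSum w - (4 / 9 + 2 * e) * n ^ 2 with hBdef
  have hB0 : 0 ≤ B := by
    have := hB 0 (by simp)
    simpa [quadForm] using this
  have hT := hw.triSum_ge_of_quadForm_ge hB
  rw [← hn] at hT
  have hTpos : 0 < triSum w := by
    have h1 : 4 / 9 * n ^ 2 ≤ edgeSum w := by
      have : 0 ≤ 2 * e * n ^ 2 := by positivity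
      linarith
    have h2 : B ≤ edgeSum w - 4 / 9 * n ^ 2 := by
      have : 0 ≤ 2 * e * n ^ 2 := by positivity
      linarith
    have h3 : 0 < 4 * edgeSum w ^ 2 - n ^ 2 * (edgeSum w + B) := by
      have h4 : n ^ 2 * (edgeSum w + B) ≤ n ^ 2 * (2 * edgeSum w - 4 / 9 * n ^ 2) :=
        mul_le_mul_of_nonneg_left (by linarith) (by positivity)
      have : 0 < n ^ 4 := by positivity
      nlinarith [sq_nonneg (2 * edgeSum w - n ^ 2 / 2)]
    by_contra! h
    nlinarith [mul_nonneg hn0.le (neg_nonneg.2 h)]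
  -- One average controls both quantities: the weight `2 / e / n` is large enough to force `Z ≤ e /
  -- 2`, and small enough that the `K₄` term stays of order `e`.
  obtain ⟨u, v, z, hD⟩ := hw.exists_rest_le hTpos (c := 2 / e / n) (by positivity)
  have hS := hw.triSum_sq_le
  have hturan := hw.edgeSum_restrict_mul_le_k4Sum (d := rest w u v z) (hw.rest_zero_or_one u v z)
  have hcut := fun r hr0 hr1 => hw.quadForm_triangle hB u v z (r := r) hr0 hr1
  have hD0 : 0 ≤ ∑ x, rest w u v z x := Finset.sum_nonneg fun x _ => by
    rcases hw.rest_zero_or_one u v z x with h | h <;> simp [h]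
  have hZ0 : 0 ≤ codegEdges w u v + codegEdges w u z + codegEdges w v z :=
    add_nonneg (add_nonneg (hw.codegEdges_nonneg _ _) (hw.codegEdges_nonneg _ _))
      (hw.codegEdges_nonneg _ _)
  have hP1 := hw.edgeSum_le
  rw [← hn] at hD hP1
  generalize edgeSum w = P at *
  generalize triSum w = T at *
  generalize bookSum w = S at *
  generalize k4Sum w = K at *
  generalize (∑ x, rest w u v z x) = D at *
  generalize codegEdges w u v + codegEdges w u z + codegEdges w v z = Z at *
  generalize quadForm w (rest w u v z) = h at *
  obtain ⟨p, rfl⟩ : ∃ p, P = p * n ^ 2 := ⟨P / n ^ 2, by field_simp⟩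
  obtain ⟨t, rfl⟩ : ∃ t, T = t * n ^ 3 := ⟨T / n ^ 3, by field_simp⟩
  obtain ⟨s, rfl⟩ : ∃ s, S = s * n ^ 4 := ⟨S / n ^ 4, by field_simp⟩
  obtain ⟨k, rfl⟩ : ∃ k, K = k * n ^ 4 := ⟨K / n ^ 4, by field_simp⟩
  obtain ⟨D, rfl⟩ : ∃ d, D = d * n := ⟨D / n, by field_simp⟩
  obtain ⟨Z, rfl⟩ : ∃ d, Z = d * n ^ 2 := ⟨Z / n ^ 2, by field_simp⟩
  obtain ⟨h, rfl⟩ : ∃ d, h = d * n ^ 2 := ⟨h / n ^ 2, by field_simp⟩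
  have n2 : 0 < n ^ 2 := by positivity
  have n4 : 0 < n ^ 4 := by positivity
  have n6 : 0 < n ^ 6 := by positivity
  rw [hBdef] at hB0 hT hcut
  refine density_contradiction (p := p) (t := t) (s := s) (k := k) (e := e) (D := D) (Z := Z)
    (h := h) he he1 ?_ ?_ ?_ ?_ ?_ ?_ ?_ ?_ ?_ ?_
  · exact le_of_mul_le_mul_right (by linarith) n2
  · exact le_of_mul_le_mul_right (by linarith) n2
  · exact le_of_mul_le_mul_right (by linarith) n4
  · exact le_of_mul_le_mul_right (by linarith) n6
  · exact le_of_mul_le_mul_right (by linarith) n4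
  · exact le_of_mul_le_mul_right (by linarith) hn0
  · exact le_of_mul_le_mul_right (by linarith) n2
  · refine le_of_mul_le_mul_right ?_ n4
    have e1 : (D * n + 2 / e / n * (Z * n ^ 2)) * (t * n ^ 3)
        = (D + 2 / e * Z) * t * n ^ 4 := by field_simp
    have e2 : n * (t * n ^ 3) - 3 * (s * n ^ 4) + 2 * (k * n ^ 4)
        + 3 * (2 / e / n) * (n * (k * n ^ 4))
        = (t - 3 * s + 2 * k + 3 * (2 / e) * k) * n ^ 4 := by field_simp
    rwa [e1, e2] at hD
  · intro r hr0 hr1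
    have := hcut r hr0 hr1
    exact le_of_mul_le_mul_right (by linarith) n2
  · exact le_of_mul_le_mul_right (by linarith) n4

end Cut

/-! ### From many copies of `K₄` to a complete 4-partite graph. -/

section BlowUp

/-- The power mean inequality: a function on `X × Y` of density at least `a` gives a function of
density at least `a ^ k` on `X ^ k × Y`. -/
lemma density_pow_le {W X Y : Type*} [Fintype W] [DecidableEq W] [Fintype X] [Fintype Y]
    [Nonempty W] (f : X → Y → ℝ) (hf : ∀ x y, 0 ≤ f x y) {a : ℝ} (ha : 0 ≤ a)
    (h : a * (Fintype.card X * Fintype.card Y) ≤ ∑ x, ∑ y, f x y) :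
    a ^ Fintype.card W * ((Fintype.card X : ℝ) ^ Fintype.card W * Fintype.card Y)
      ≤ ∑ g : W → X, ∑ y, ∏ i, f (g i) y := by
  have h1 : ∑ g : W → X, ∑ y, ∏ i, f (g i) y = ∑ y, (∑ x, f x y) ^ Fintype.card W := by
    rw [Finset.sum_comm]
    refine Finset.sum_congr rfl fun y _ => ?_
    rw [← Finset.card_univ, ← Finset.prod_const, Finset.prod_univ_sum,
      Fintype.piFinset_univ]
  rw [h1]
  obtain ⟨k, hk⟩ : ∃ k, Fintype.card W = k + 1 :=
    ⟨Fintype.card W - 1, (Nat.sub_add_cancel Fintype.card_pos).symm⟩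
  rcases isEmpty_or_nonempty Y with hY | hY
  · simp
  have hYpos : (0 : ℝ) < Fintype.card Y := by exact_mod_cast Fintype.card_pos
  have h2 := pow_sum_div_card_le_sum_pow (s := (Finset.univ : Finset Y))
    (f := fun y => ∑ x, f x y) (fun y _ => Finset.sum_nonneg fun x _ => hf x y) k
  rw [hk]
  refine le_trans ?_ h2
  rw [Finset.card_univ, le_div_iff₀ (by positivity), Finset.sum_comm]
  refine le_trans (le_of_eq ?_) (pow_le_pow_left₀ (by positivity) h (k + 1))
  ring

/-- Overwriting the value at `i` is injective on pairs `(g, x)`, since `g i` can be read off as `g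
j`. -/
lemma card_eq_le {W V : Type*} [Fintype W] [DecidableEq W] [Fintype V] [DecidableEq V]
    {i j : W} (hij : i ≠ j) :
    (Finset.univ.filter fun g : W → V => g i = g j).card * Fintype.card V
      ≤ Fintype.card V ^ Fintype.card W := by
  rw [← Fintype.card_fun, ← Finset.card_univ (α := V), ← Finset.card_product,
    ← Finset.card_univ (α := W → V)]
  refine Finset.card_le_card_of_injOn (fun e => Function.update e.1 i e.2)
    (fun _ _ => Finset.mem_coe.2 (Finset.mem_univ _)) ?_
  rintro ⟨g, x⟩ hg ⟨g', x'⟩ hg' h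
  simp only [Finset.coe_product, Set.mem_prod, Finset.mem_coe, Finset.mem_filter,
    Finset.mem_univ, true_and, and_true] at hg hg'
  simp only at h
  have hx : x = x' := by simpa using congrFun h i
  have hne : ∀ l, l ≠ i → g l = g' l := fun l hl => by
    simpa [Function.update_of_ne hl] using congrFun h l
  refine Prod.ext (funext fun l => ?_) hx
  by_cases hl : l = i
  · rw [hl]
    change g i = g' i
    rw [hg, hg', hne j hij.symm]
  · exact hne l hl

lemma card_not_injective_le {W V : Type*} [Fintype W] [DecidableEq W] [Fintype V]
    [DecidableEq V] :
    (Finset.univ.filter fun g : W → V => ¬ Function.Injective g).card * Fintype.card V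
      ≤ Fintype.card W ^ 2 * Fintype.card V ^ Fintype.card W := by
  have h1 : (Finset.univ.filter fun g : W → V => ¬ Function.Injective g) ⊆
      (Finset.univ.filter fun e : W × W => e.1 ≠ e.2).biUnion
        fun e => Finset.univ.filter fun g : W → V => g e.1 = g e.2 := by
    intro g hg
    obtain ⟨i, j, h, hij⟩ := Function.not_injective_iff.1 (Finset.mem_filter.1 hg).2
    simp only [Finset.mem_biUnion, Finset.mem_filter, Finset.mem_univ, true_and]
    exact ⟨(i, j), hij, h⟩
  calc _ ≤ (∑ e ∈ Finset.univ.filter fun e : W × W => e.1 ≠ e.2,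
        (Finset.univ.filter fun g : W → V => g e.1 = g e.2).card) * Fintype.card V :=
        Nat.mul_le_mul_right _ ((Finset.card_le_card h1).trans Finset.card_biUnion_le)
    _ ≤ ∑ e ∈ Finset.univ.filter fun e : W × W => e.1 ≠ e.2,
          Fintype.card V ^ Fintype.card W := by
        rw [Finset.sum_mul]
        exact Finset.sum_le_sum fun e he => card_eq_le (Finset.mem_filter.1 he).2
    _ ≤ _ := by
        rw [Finset.sum_const, smul_eq_mul]
        refine Nat.mul_le_mul_right _ ((Finset.card_filter_le _ _).trans ?_)
        rw [Finset.card_univ, Fintype.card_prod, sq]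

/-- A `0`-`1` function on quadruples of positive density is equal to `1` on a product of
four injective families. -/
theorem exists_injective_blowUp {W V : Type*} [Fintype W] [Nonempty W] [Fintype V]
    [Nonempty V] (f : V → V → V → V → ℝ) (hf0 : ∀ u v z x, 0 ≤ f u v z x)
    (hf1 : ∀ u v z x, f u v z x ≤ 1) {a : ℝ} (ha : 0 ≤ a)
    (h : a * (Fintype.card V : ℝ) ^ 4 ≤ ∑ u, ∑ v, ∑ z, ∑ x, f u v z x)
    (hV : 4 * (Fintype.card W : ℝ) ^ 2 < a ^ (Fintype.card W ^ 4) * Fintype.card V) :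
    ∃ g₁ g₂ g₃ g₄ : W → V, g₁.Injective ∧ g₂.Injective ∧ g₃.Injective ∧ g₄.Injective ∧
      ∀ i j k l, f (g₁ i) (g₂ j) (g₃ k) (g₄ l) ≠ 0 := by
  classical
  set k := Fintype.card W with hk
  set n := Fintype.card V with hn
  -- Each application replaces one vertex by a family `W → V` and raises the density to the power
  -- `k`; four of them give `a ^ k ^ 4`.
  have s1 := density_pow_le (W := W) (X := V) (Y := V × V × V)
    (fun u e => f u e.1 e.2.1 e.2.2) (fun _ _ => hf0 _ _ _ _) ha (by
      simp only [Fintype.sum_prod_type, Fintype.card_prod, ← hn]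
      refine le_trans (le_of_eq ?_) h
      push_cast; ring)
  have s2 := density_pow_le (W := W) (X := V) (Y := (W → V) × V × V)
    (fun v e => ∏ i, f (e.1 i) v e.2.1 e.2.2) (fun _ _ => Finset.prod_nonneg fun _ _ => hf0 _ _ _ _)
    (pow_nonneg ha k) (by
      simp only [Fintype.sum_prod_type, Fintype.card_prod, Fintype.card_fun, ← hn, ← hk] at s1 ⊢
      rw [Finset.sum_comm]
      refine le_trans (le_of_eq ?_) s1
      push_cast; ring)
  have s3 := density_pow_le (W := W) (X := V) (Y := (W → V) × (W → V) × V)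
    (fun z e => ∏ j, ∏ i, f (e.1 i) (e.2.1 j) z e.2.2)
    (fun _ _ => Finset.prod_nonneg fun _ _ => Finset.prod_nonneg fun _ _ => hf0 _ _ _ _)
    (pow_nonneg (pow_nonneg ha k) k) (by
      simp only [Fintype.sum_prod_type, Fintype.card_prod, Fintype.card_fun, ← hn, ← hk] at s2 ⊢
      have e : ∀ F : V → (W → V) → (W → V) → V → ℝ,
          ∑ z, ∑ g, ∑ g', ∑ x, F z g g' x = ∑ g', ∑ g, ∑ z, ∑ x, F z g g' x := by
        intro F
        rw [Finset.sum_comm]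
        simp_rw [fun g => Finset.sum_comm (s := Finset.univ) (t := Finset.univ)
          (f := fun z g' => ∑ x, F z g g' x)]
        exact Finset.sum_comm
      rw [e]
      refine le_trans (le_of_eq ?_) s2
      push_cast; ring)
  have s4 := density_pow_le (W := W) (X := V) (Y := (W → V) × (W → V) × (W → V))
    (fun x e => ∏ l, ∏ j, ∏ i, f (e.1 i) (e.2.1 j) (e.2.2 l) x)
    (fun _ _ => Finset.prod_nonneg fun _ _ => Finset.prod_nonneg fun _ _ =>
      Finset.prod_nonneg fun _ _ => hf0 _ _ _ _)
    (pow_nonneg (pow_nonneg (pow_nonneg ha k) k) k) (by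
      simp only [Fintype.sum_prod_type, Fintype.card_prod, Fintype.card_fun, ← hn, ← hk] at s3 ⊢
      have e : ∀ F : V → (W → V) → (W → V) → (W → V) → ℝ,
          ∑ x, ∑ g, ∑ g', ∑ g'', F x g g' g'' = ∑ g'', ∑ g, ∑ g', ∑ x, F x g g' g'' := by
        intro F
        rw [Finset.sum_comm]
        simp_rw [fun g => Finset.sum_comm (s := Finset.univ) (t := Finset.univ)
          (f := fun x g' => ∑ g'', F x g g' g'')]
        simp_rw [fun g g' => Finset.sum_comm (s := Finset.univ) (t := Finset.univ)
          (f := fun x g'' => F x g g' g'')]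
        simp_rw [fun g => Finset.sum_comm (s := Finset.univ) (t := Finset.univ)
          (f := fun g' g'' => ∑ x, F x g g' g'')]
        exact Finset.sum_comm
      rw [e]
      refine le_trans (le_of_eq ?_) s3
      push_cast; ring)
  simp only [Fintype.card_prod, Fintype.card_fun, ← hn, ← hk, ← pow_mul] at s4
  have hkk : k * k * k * k = k ^ 4 := by ring
  rw [hkk] at s4
  by_contra! hcon
  let N : Finset (W → V) := Finset.univ.filter fun g : W → V => ¬ Function.Injective g
  let ind : (W → V) → ℝ := fun g => if g ∈ N then 1 else 0
  have hind0 : ∀ g, 0 ≤ ind g := fun g => by dsimp only [ind]; split_ifs <;> norm_num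
  have hmem : ∀ g, ¬ Function.Injective g → ind g = 1 := fun g hg => by
    dsimp only [ind, N]; simp [hg]
  -- Without a good injective quadruple, every nonzero product involves a non-injective family;
  -- these have proportion at most `k² / n` in each of the four places.
  have bound : ∀ g₄ g₁ g₂ g₃ : W → V,
      ∏ m, ∏ l, ∏ j, ∏ i, f (g₁ i) (g₂ j) (g₃ l) (g₄ m) ≤ ind g₁ + ind g₂ + ind g₃ + ind g₄ := by
    intro g₄ g₁ g₂ g₃
    have hle : ∏ m, ∏ l, ∏ j, ∏ i, f (g₁ i) (g₂ j) (g₃ l) (g₄ m) ≤ 1 :=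
      Finset.prod_le_one (fun _ _ => Finset.prod_nonneg fun _ _ => Finset.prod_nonneg fun _ _ =>
        Finset.prod_nonneg fun _ _ => hf0 _ _ _ _) fun _ _ =>
      Finset.prod_le_one (fun _ _ => Finset.prod_nonneg fun _ _ =>
        Finset.prod_nonneg fun _ _ => hf0 _ _ _ _) fun _ _ =>
      Finset.prod_le_one (fun _ _ => Finset.prod_nonneg fun _ _ => hf0 _ _ _ _) fun _ _ =>
      Finset.prod_le_one (fun _ _ => hf0 _ _ _ _) fun _ _ => hf1 _ _ _ _
    have b1 := hind0 g₁
    have b2 := hind0 g₂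
    have b3 := hind0 g₃
    have b4 := hind0 g₄
    by_cases i1 : g₁.Injective
    · by_cases i2 : g₂.Injective
      · by_cases i3 : g₃.Injective
        · by_cases i4 : g₄.Injective
          · obtain ⟨i, j, l, m, h0⟩ := hcon g₁ g₂ g₃ g₄ i1 i2 i3 i4
            have : ∏ m, ∏ l, ∏ j, ∏ i, f (g₁ i) (g₂ j) (g₃ l) (g₄ m) = 0 :=
              Finset.prod_eq_zero (Finset.mem_univ m) <|
              Finset.prod_eq_zero (Finset.mem_univ l) <|
              Finset.prod_eq_zero (Finset.mem_univ j) <|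
              Finset.prod_eq_zero (Finset.mem_univ i) h0
            linarith
          · linarith [hmem _ i4]
        · linarith [hmem _ i3]
      · linarith [hmem _ i2]
    · linarith [hmem _ i1]
  have hN : ∑ g, ind g = (N.card : ℝ) := by
    simp only [ind, Finset.sum_ite_mem, Finset.univ_inter, Finset.sum_const, nsmul_eq_mul, mul_one]
  have s5 := s4.trans (Finset.sum_le_sum fun g₄ _ => Finset.sum_le_sum fun e _ =>
    bound g₄ e.1 e.2.1 e.2.2)
  simp only [Fintype.sum_prod_type, Finset.sum_add_distrib, Finset.sum_const, Finset.card_univ,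
    Fintype.card_fun, nsmul_eq_mul, ← Finset.mul_sum, hN, ← hn, ← hk, Fintype.card_prod] at s5
  have hc : (N.card : ℝ) * n ≤ (k : ℝ) ^ 2 * (n : ℝ) ^ k := by
    exact_mod_cast card_not_injective_le (W := W) (V := V)
  have hn0 : (0 : ℝ) < n := by rw [hn]; exact_mod_cast Fintype.card_pos
  push_cast at s5
  have hM : 0 < (n : ℝ) ^ k := by positivity
  generalize (n : ℝ) ^ k = M at *
  have s6 : a ^ k ^ 4 * n * M ^ 4 ≤ 4 * (N.card * n) * M ^ 3 := by nlinarith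
  have s7 : 4 * (N.card * n) * M ^ 3 ≤ 4 * (k : ℝ) ^ 2 * M ^ 4 := by
    have := mul_le_mul_of_nonneg_right hc (by positivity : 0 ≤ M ^ 3)
    nlinarith
  have s8 : 4 * (k : ℝ) ^ 2 * M ^ 4 < a ^ k ^ 4 * n * M ^ 4 :=
    mul_lt_mul_of_pos_right hV (by positivity)
  linarith

end BlowUp

/-! ### Translation to graphs. -/

section Graph

/-- `G` can be made bipartite by deleting at most `c` of its edges. -/
def SimpleGraph.BipartiteWithin {V : Type*} (G : SimpleGraph V) (c : ℝ) : Prop :=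
  ∃ D : Finset (Sym2 V), (D : Set (Sym2 V)) ⊆ G.edgeSet ∧
    (G.deleteEdges (D : Set (Sym2 V))).IsBipartite ∧ (D.card : ℝ) ≤ c

/-- The real adjacency matrix of a graph, as a function. -/
noncomputable def adjWeight {V : Type*} (G : SimpleGraph V) (u v : V) : ℝ :=
  open Classical in if G.Adj u v then 1 else 0

lemma adjWeight_isZeroOneSymm {V : Type*} (G : SimpleGraph V) : IsZeroOneSymm (adjWeight G) := by
  refine ⟨fun u v => ?_, fun u v => ?_⟩
  · by_cases h : G.Adj u v
    · simp [adjWeight, h, h.symm]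
    · have h' : ¬ G.Adj v u := fun h' => h h'.symm
      simp [adjWeight, h, h']
  · by_cases h : G.Adj u v <;> simp [adjWeight, h]

lemma adj_of_adjWeight_ne_zero {V : Type*} {G : SimpleGraph V} {u v : V}
    (h : adjWeight G u v ≠ 0) : G.Adj u v := by
  by_contra hc
  exact h (by simp [adjWeight, hc])

variable {V : Type*} [Fintype V]

/-- A sign vector defines a cut. -/
lemma SimpleGraph.bipartiteWithin_of_sign (G : SimpleGraph V) {s : V → ℝ}
    (hs : ∀ v, s v = 1 ∨ s v = -1) :
    G.BipartiteWithin ((edgeSum (adjWeight G) + quadForm (adjWeight G) s) / 4) := by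
  classical
  let G' : SimpleGraph V :=
    { Adj := fun u v => G.Adj u v ∧ s u = s v
      symm := ⟨fun u v h => ⟨h.1.symm, h.2.symm⟩⟩
      loopless := ⟨fun v h => G.loopless.irrefl v h.1⟩ }
  have hcard : (2 : ℝ) * G'.edgeFinset.card = ∑ u, ∑ v, if G'.Adj u v then (1 : ℝ) else 0 := by
    have h := G'.sum_degrees_eq_twice_card_edges
    rw [← Nat.cast_ofNat, ← Nat.cast_mul, ← h, Nat.cast_sum]
    refine Finset.sum_congr rfl fun u _ => ?_
    rw [← G'.card_neighborFinset_eq_degree, G'.neighborFinset_eq_filter, Finset.sum_boole]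
  refine ⟨G'.edgeFinset, ?_, ?_, ?_⟩
  · rw [SimpleGraph.coe_edgeFinset]
    exact SimpleGraph.edgeSet_mono fun u v h => h.1
  · refine ⟨SimpleGraph.Coloring.mk (fun v => if s v = 1 then (0 : Fin 2) else 1) ?_⟩
    intro u v h heq
    rw [SimpleGraph.deleteEdges_adj, SimpleGraph.coe_edgeFinset, SimpleGraph.mem_edgeSet] at h
    refine h.2 ⟨h.1, ?_⟩
    rcases hs u with h1 | h1 <;> rcases hs v with h2 | h2 <;> rw [h1, h2] at heq ⊢ <;>
      norm_num at heq
  -- `1 + s u * s v` is 2 on uncut pairs and 0 on cut ones; the order of the endpoints gives another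
  -- factor 2.
  · have h2 : edgeSum (adjWeight G) + quadForm (adjWeight G) s
        = 2 * ∑ u, ∑ v, if G'.Adj u v then (1 : ℝ) else 0 := by
      simp only [edgeSum, quadForm, ← Finset.sum_add_distrib, Finset.mul_sum]
      refine Finset.sum_congr rfl fun u _ => Finset.sum_congr rfl fun v _ => ?_
      by_cases h : G.Adj u v
      · rcases hs u with h1 | h1 <;> rcases hs v with h2 | h2 <;>
          norm_num [adjWeight, G', h, h1, h2]
      · simp [adjWeight, G', h]
    rw [h2]
    linarith

lemma SimpleGraph.bipartiteWithin_card_sq (G : SimpleGraph V) :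
    G.BipartiteWithin ((Fintype.card V : ℝ) ^ 2) := by
  obtain ⟨D, h1, h2, h3⟩ := G.bipartiteWithin_of_sign (s := fun _ => 1) fun _ => Or.inl rfl
  refine ⟨D, h1, h2, h3.trans ?_⟩
  have h := (adjWeight_isZeroOneSymm G).edgeSum_le
  have h' : quadForm (adjWeight G) (fun _ => 1) = edgeSum (adjWeight G) := by
    simp [quadForm, edgeSum]
  rw [h']
  nlinarith [(adjWeight_isZeroOneSymm G).edgeSum_nonneg]

/-- A large graph with many copies of `K₄` contains every fixed `4`-colorable graph. -/
theorem SimpleGraph.isContained_of_k4Sum_ge {W : Type*} [Fintype W] [Nonempty W]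
    {H : SimpleGraph W} (hH : H.Colorable 4) [Nonempty V] {G : SimpleGraph V} {a : ℝ}
    (ha : 0 ≤ a) (h : a * (Fintype.card V : ℝ) ^ 4 ≤ k4Sum (adjWeight G))
    (hV : 4 * (Fintype.card W : ℝ) ^ 2 < a ^ (Fintype.card W ^ 4) * Fintype.card V) :
    H.IsContained G := by
  have hw := adjWeight_isZeroOneSymm G
  obtain ⟨g₁, g₂, g₃, g₄, i1, i2, i3, i4, hg⟩ := exists_injective_blowUp
    (fun u v z x => tri (adjWeight G) u v z
      * (adjWeight G u x * adjWeight G v x * adjWeight G z x))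
    (fun u v z x => mul_nonneg (hw.tri_nonneg _ _ _)
      (mul_nonneg (mul_nonneg (hw.nonneg _ _) (hw.nonneg _ _)) (hw.nonneg _ _)))
    (fun u v z x => mul_le_one₀ (mul_le_one₀ (mul_le_one₀ (hw.le_one _ _) (hw.nonneg _ _)
        (hw.le_one _ _)) (hw.nonneg _ _) (hw.le_one _ _))
      (mul_nonneg (mul_nonneg (hw.nonneg _ _) (hw.nonneg _ _)) (hw.nonneg _ _))
      (mul_le_one₀ (mul_le_one₀ (hw.le_one _ _) (hw.nonneg _ _)
        (hw.le_one _ _)) (hw.nonneg _ _) (hw.le_one _ _))) ha h hV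
  have hadj : ∀ i j k l, (G.Adj (g₁ i) (g₂ j) ∧ G.Adj (g₁ i) (g₃ k) ∧ G.Adj (g₂ j) (g₃ k)) ∧
      G.Adj (g₁ i) (g₄ l) ∧ G.Adj (g₂ j) (g₄ l) ∧ G.Adj (g₃ k) (g₄ l) := by
    intro i j k l
    have h1 := hg i j k l
    simp only [tri, mul_ne_zero_iff] at h1
    obtain ⟨⟨⟨h1, h2⟩, h3⟩, ⟨h4, h5⟩, h6⟩ := h1
    exact ⟨⟨adj_of_adjWeight_ne_zero h1, adj_of_adjWeight_ne_zero h2,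
      adj_of_adjWeight_ne_zero h3⟩, adj_of_adjWeight_ne_zero h4, adj_of_adjWeight_ne_zero h5,
      adj_of_adjWeight_ne_zero h6⟩
  let g : Fin 4 → W → V := ![g₁, g₂, g₃, g₄]
  have hginj : ∀ c, (g c).Injective := by
    intro c
    fin_cases c <;> assumption
  have hgadj : ∀ c c', c < c' → ∀ i j, G.Adj (g c i) (g c' j) := by
    intro c c' hc i j
    fin_cases c <;> fin_cases c' <;> first | exact absurd hc (by decide) | skip
    · exact (hadj i j i i).1.1
    · exact (hadj i i j i).1.2.1
    · exact (hadj i i i j).2.1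
    · exact (hadj i i j i).1.2.2
    · exact (hadj i i i j).2.2.1
    · exact (hadj i i i j).2.2.2
  have hgadj' : ∀ c c', c ≠ c' → ∀ i j, G.Adj (g c i) (g c' j) := fun c c' hc i j =>
    (lt_or_gt_of_ne hc).elim (fun h => hgadj c c' h i j) fun h => (hgadj c' c h j i).symm
  obtain ⟨C⟩ := hH
  -- Each vertex goes to its own copy within the family of its colour. Different families have
  -- disjoint ranges, being completely joined in a loopless graph.
  refine ⟨⟨⟨fun i => g (C i) i, fun {i j} hij => hgadj' _ _ (C.valid hij) i j⟩, ?_⟩⟩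
  intro i j hij
  change g (C i) i = g (C j) j at hij
  by_cases hc : C i = C j
  · rw [hc] at hij
    exact hginj _ hij
  · exact absurd (hij ▸ hgadj' _ _ hc i j) (G.loopless.irrefl _)

/-- A large graph without a fixed `4`-colorable subgraph can be made bipartite by deleting
roughly `n ^ 2 / 9` edges. -/
theorem SimpleGraph.bipartiteWithin_of_free {W : Type*} [Fintype W] [Nonempty W]
    {H : SimpleGraph W} (hH : H.Colorable 4) [Nonempty V] {G : SimpleGraph V} (hG : H.Free G)
    {e : ℝ} (he : 0 < e) (he1 : e ≤ 1)
    (hV : 4 * (Fintype.card W : ℝ) ^ 2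
      < (e ^ 2 / 100) ^ (Fintype.card W ^ 4) * Fintype.card V) :
    G.BipartiteWithin ((1 + 5 * e) * ((Fintype.card V : ℝ) ^ 2 / 9)) := by
  have hw := adjWeight_isZeroOneSymm G
  have hK : k4Sum (adjWeight G) ≤ e ^ 2 / 100 * (Fintype.card V : ℝ) ^ 4 := by
    by_contra! h
    exact hG (SimpleGraph.isContained_of_k4Sum_ge hH (by positivity) h.le hV)
  obtain ⟨s, hs, hle⟩ := hw.exists_sign_quadForm_le_card_sq (fun v => by simp [adjWeight]) he he1 hK
  obtain ⟨D, h1, h2, h3⟩ := G.bipartiteWithin_of_sign hs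
  refine ⟨D, h1, h2, h3.trans ?_⟩
  have : 0 ≤ e * (Fintype.card V : ℝ) ^ 2 := by positivity
  linarith

end Graph

/-! ### The error function. -/

theorem corollary2 {W : Type*} [Fintype W] (H : SimpleGraph W) (hH : H.chromaticNumber = 4) :
    ∃ err : ℕ → ℝ, Tendsto err atTop (𝓝 0) ∧
      ∀ (V : Type*) [Fintype V] (G : SimpleGraph V), H.Free G →
        ∃ D : Finset (Sym2 V), (D : Set (Sym2 V)) ⊆ G.edgeSet ∧
          (G.deleteEdges (D : Set (Sym2 V))).IsBipartite ∧
          (D.card : ℝ) ≤ (1 + err (Fintype.card V)) * ((Fintype.card V : ℝ) ^ 2 / 9) := by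
  have hcol : H.Colorable 4 := SimpleGraph.chromaticNumber_le_iff_colorable.1 hH.le
  have hW : Nonempty W := by
    by_contra h
    rw [not_nonempty_iff] at h
    rw [SimpleGraph.chromaticNumber_eq_zero_of_isEmpty] at hH
    norm_num at hH
  let S : ℕ → Set ℝ := fun n => {c | 0 ≤ c ∧ ∀ (V : Type _) [Fintype V] (G : SimpleGraph V),
    Fintype.card V = n → H.Free G → G.BipartiteWithin ((1 + c) * ((n : ℝ) ^ 2 / 9))}
  have hbdd : ∀ n, BddBelow (S n) := fun n => ⟨0, fun c hc => hc.1⟩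
  have hne : ∀ n, (S n).Nonempty := by
    -- With `c = 8` the bound is `n ^ 2`.
    refine fun n => ⟨8, by norm_num, fun V _ G hV _ => ?_⟩
    have h := G.bipartiteWithin_card_sq
    rw [hV] at h
    convert h using 1
    ring
  -- The infimum need not be attained, so a vanishing slack is added.
  refine ⟨fun n => sInf (S n) + 1 / ((n : ℝ) + 1), ?_, ?_⟩
  · rw [← add_zero (0 : ℝ)]
    refine Tendsto.add ?_ tendsto_one_div_add_atTop_nhds_zero_nat
    rw [Metric.tendsto_atTop]
    intro ε hε
    set e := min (ε / 10) 1 with he_def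
    have he : 0 < e := lt_min (by linarith) one_pos
    have hq : 0 < (e ^ 2 / 100) ^ (Fintype.card W ^ 4) := by positivity
    obtain ⟨N, hN⟩ := exists_nat_gt (4 * (Fintype.card W : ℝ) ^ 2
      / (e ^ 2 / 100) ^ (Fintype.card W ^ 4))
    rw [div_lt_iff₀' hq] at hN
    -- The 1 ensures that `V` is nonempty.
    refine ⟨max N 1, fun n hn => ?_⟩
    have hmem : 5 * e ∈ S n := by
      refine ⟨by linarith, fun V _ G hV hG => ?_⟩
      have : Nonempty V := Fintype.card_pos_iff.1 (by have := le_of_max_le_right hn; omega)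
      have h := SimpleGraph.bipartiteWithin_of_free hcol hG he (min_le_right _ _) (by
        refine hN.trans_le (mul_le_mul_of_nonneg_left ?_ hq.le)
        rw [hV]
        exact_mod_cast le_of_max_le_left hn)
      rwa [hV] at h
    have h1 : sInf (S n) ≤ 5 * e := csInf_le (hbdd n) hmem
    have h2 : 0 ≤ sInf (S n) := le_csInf (hne n) fun c hc => hc.1
    rw [Real.dist_eq, sub_zero, abs_of_nonneg h2]
    linarith [min_le_left (ε / 10) 1]
  · intro V _ G hG
    set n := Fintype.card V with hn
    obtain ⟨c, hc, hlt⟩ := exists_lt_of_csInf_lt (hne n)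
      (lt_add_of_pos_right (sInf (S n)) (by positivity : (0 : ℝ) < 1 / ((n : ℝ) + 1)))
    obtain ⟨D, h1, h2, h3⟩ := hc.2 V G hn.symm hG
    exact ⟨D, h1, h2, h3.trans (mul_le_mul_of_nonneg_right (by linarith) (by positivity))⟩
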